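/- Let $\mathcal W_n$ be the set of walks $(z_0,\dots,z_{3n})$ in $\mathbb Z^2$ with $3n$ steps such that: (1) the walk starts and ends at $(0,0)$ and stays in the closed first quadrant; (2) every step is one of $(0,1)$, $(-1,0)$, $(1,-1)$; (3) no $(1,-1)$-step is immediately preceded by a $(-1,0)$-step. For each $n\ge 1$, let $w_1,\dots,w_{3n}$ be a Markov chain on $\{\mathrm b,\mathrm r,\mathrm g\}$ with $w_1=\mathrm g$ and transition matrix (rows and columns in the order $\mathrm b,\mathrm r,\mathrm g$) $$P=\begin{pmatrix}\tfrac12&\tfrac14&\tfrac14\\[2pt] 0&\tfrac12&\tfrac12\\[2pt] \tfrac12&\tfrac14&\tfrac14\end{pmatrix}.$$ Put $f(\mathrm b)=(1,-1)$, $f(\mathrm r)=(-1,0)$, $f(\mathrm g)=(0,1)$, and define the lattice walk $Z^{\mathrm b,n}$ by $Z^{\mathrm b,n}_0=(0,0)$ and $Z^{\mathrm b,n}_k-Z^{\mathrm b,n}_{k-1}=f(w_k)$ for $1\le k\le 3n$. Then for every $n\ge1$ the set $\mathcal W_n$ is finite, the event $\{Z^{\mathrm b,n}\in\mathcal W_n\}$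 has positive probability, $\mathbb P[Z^{\mathrm b,n}=z]=2\cdot 16^{-n}$ for every $z\in\mathcal W_n$, and the conditional law of $Z^{\mathrm b,n}$ given $\{Z^{\mathrm b,n}\in\mathcal W_n\}$ is the uniform measure on $\mathcal W_n$. Moreover, $$\mathbb P[Z^{\mathrm b,n}\in\mathcal W_n]=\left(\tfrac{48}{\pi}+o_n(1)\right)n^{-5},$$ where $o_n(1)$ denotes a quantity tending to zero as $n\to\infty$. -/

import Mathlib

namespace SchnyderWalk

/-- The three colours (letters): blue, red and green. -/
inductive Color where
  | b
  | r
  | g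
  deriving DecidableEq

instance : Fintype Color :=
  ⟨{Color.b, Color.r, Color.g}, fun c => by cases c <;> decide⟩

/-- The finite set of colours carries the discrete sigma-algebra. -/
instance : MeasurableSpace Color := ⊤

/-- The transition matrix `P`; the entry `transition x y` is the probability of moving
from `x` to `y`. -/
noncomputable def transition : Matrix Color Color ℝ
  | .b, .b => 1 / 2
  | .b, .r => 1 / 4
  | .b, .g => 1 / 4
  | .r, .b => 0
  | .r, .r => 1 / 2
  | .r, .g => 1 / 2
  | .g, .b => 1 / 2
  | .g, .r => 1 / 4
  | .g, .g => 1 / 4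

/-- The increment in `ℤ²` associated with a colour. -/
def increment : Color → ℤ × ℤ
  | .b => (1, -1)
  | .r => (-1, 0)
  | .g => (0, 1)

/-- `w 0, w 1, …, w (N - 1)` is a Markov chain of length `N` on the state space `S`, under the
measure `μ`, with initial state `x₀` and transition matrix `P`: given any history
`(w 0, …, w i) = (x 0, …, x i)` of positive probability, the next state `w (i + 1)` is equal to
`y` with conditional probability `P (x i) y`. -/
structure IsMarkovChain {Ω S : Type*} [MeasurableSpace Ω] [MeasurableSpace S]
    (μ : MeasureTheory.Measure Ω) (P : Matrix S S ℝ) (x₀ : S) {N : ℕ}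
    (w : Fin N → Ω → S) : Prop where
  measurable : ∀ i, Measurable (w i)
  initial : ∀ i : Fin N, (i : ℕ) = 0 → ∀ᵐ ω ∂μ, w i ω = x₀
  step : ∀ i j : Fin N, (j : ℕ) = (i : ℕ) + 1 → ∀ (x : Fin N → S) (y : S),
    μ {ω | ∀ l ≤ i, w l ω = x l} ≠ 0 →
      (ProbabilityTheory.cond μ {ω | ∀ l ≤ i, w l ω = x l}).real {ω | w j ω = y} = P (x i) y

/-- The lattice walk `Z` driven by a (random) word `w` of length `N`: it is given by `Z 0 = (0, 0)`
and `Z (i + 1) = Z i + increment (w i)`, for `i = 0, …, N - 1`. -/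
def walk {Ω : Type*} {N : ℕ} (w : Fin N → Ω → Color) (ω : Ω) : Fin (N + 1) → ℤ × ℤ :=
  Fin.partialSum fun i => increment (w i ω)

/-- The increment of the path `z` between times `i` and `i + 1`. -/
def pathStep {N : ℕ} (z : Fin (N + 1) → ℤ × ℤ) (i : Fin N) : ℤ × ℤ :=
  z i.succ - z i.castSucc

/-- The set `𝒲ₙ` of walks with `3n` steps in `ℤ²` which start and end at the origin, stay in the
closed first quadrant, have all their steps in `{(0, 1), (-1, 0), (1, -1)}`, and in which no
`(1, -1)`-step is immediately preceded by a `(-1, 0)`-step. -/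
def walkSet (n : ℕ) : Set (Fin (3 * n + 1) → ℤ × ℤ) :=
  {z | z 0 = (0, 0) ∧ z (Fin.last (3 * n)) = (0, 0) ∧
    (∀ k, 0 ≤ (z k).1 ∧ 0 ≤ (z k).2) ∧
    (∀ i, pathStep z i = (0, 1) ∨ pathStep z i = (-1, 0) ∨ pathStep z i = (1, -1)) ∧
    ∀ i j : Fin (3 * n), (j : ℕ) = (i : ℕ) + 1 →
      ¬(pathStep z i = (-1, 0) ∧ pathStep z j = (1, -1))}

end SchnyderWalk

/-! A walk in `walkSet n` is the same as a word of colours. Off the forbidden pair red-blue,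
`transition` has rank one (`transition_eq_mul`), so the probability of an admissible word is a
product of letter weights, up to corrections at its two ends: the first letter is forced green and
the last red, which gives the factor 2. On a closed path the weights multiply to `16⁻ⁿ`. All walks
are thus equally likely, and uniformity follows.

It remains to count. Deleting the last letter gives a recursion with boundary conditions, solved by
a determinant of ballot numbers (`card_admissibleWords`). On the diagonal, with Catalan numbers `C`,
it equals `C n * C (n+2) - C (n+1) ^ 2`, hence the closed form `wordCount_self`; Wallis' product
then gives the asymptotics. -/

namespace SchnyderWalk

/-! ### Ballot numbers, their determinant and its asymptotics -/

/-- Binomial coefficients with integer arguments, vanishing for negative lower index. -/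
def intChoose (n i : ℤ) : ℤ := if i < 0 then 0 else (n.toNat.choose i.toNat : ℤ)

theorem intChoose_of_neg {n i : ℤ} (hi : i < 0) : intChoose n i = 0 := if_pos hi

theorem intChoose_natCast (n i : ℕ) : intChoose n i = n.choose i := by
  simp [intChoose]

theorem intChoose_pascal {n : ℤ} (hn : 1 ≤ n) (i : ℤ) :
    intChoose n i = intChoose (n - 1) i + intChoose (n - 1) (i - 1) := by
  obtain ⟨m, rfl⟩ : ∃ m : ℕ, n = m + 1 := ⟨(n - 1).toNat, by omega⟩
  rcases lt_trichotomy i 0 with hi | rfl | hi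
  · rw [intChoose_of_neg hi, intChoose_of_neg hi, intChoose_of_neg (by omega), add_zero]
  · simp [intChoose]
  · obtain ⟨l, rfl⟩ : ∃ l : ℕ, i = l + 1 := ⟨(i - 1).toNat, by omega⟩
    simp only [add_sub_cancel_right, intChoose_natCast]
    have h := intChoose_natCast (m + 1) (l + 1)
    have h' := intChoose_natCast m (l + 1)
    push_cast at h h'
    rw [h, h', Nat.choose_succ_succ]
    push_cast
    ring

/-- The ballot numbers: the number of words with `k` letters of a first kind and `i` letters of a
second kind in which no prefix has more letters of the second kind than of the first. -/
def ballot (k i : ℤ) : ℤ := intChoose (k + i) i - intChoose (k + i) (i - 1)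

theorem ballot_of_neg {k i : ℤ} (hi : i < 0) : ballot k i = 0 := by
  rw [ballot, intChoose_of_neg hi, intChoose_of_neg (by omega), sub_zero]

/-- Pascal's rule in both terms. Since `i ≤ k` is not required, the recursion may be used across the
diagonal. -/
theorem ballot_recursion {k i : ℤ} (h : 1 ≤ k + i) :
    ballot k i = ballot (k - 1) i + ballot k (i - 1) := by
  have h₁ := intChoose_pascal h i
  have h₂ := intChoose_pascal h (i - 1)
  simp only [ballot]
  rw [show k - 1 + i = k + i - 1 by ring, show k + (i - 1) = k + i - 1 by ring]
  linarith

theorem ballot_self_add_one {k : ℤ} (hk : 0 ≤ k) : ballot k (k + 1) = 0 := by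
  obtain ⟨m, rfl⟩ := Int.eq_ofNat_of_zero_le hk
  have h₁ := intChoose_natCast (2 * m + 1) (m + 1)
  have h₂ := intChoose_natCast (2 * m + 1) m
  push_cast at h₁ h₂
  rw [ballot, show (m : ℤ) + (m + 1) = 2 * m + 1 by ring, add_sub_cancel_right, h₁, h₂, sub_eq_zero]
  exact_mod_cast Nat.choose_symm_half m

theorem ballot_zero_zero : ballot 0 0 = 1 := by
  simp [ballot, intChoose]

theorem succ_mul_ballot_self (n : ℕ) : ((n : ℤ) + 1) * ballot n n = n.centralBinom := by
  rcases n with _ | m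
  · simp [ballot_zero_zero]
  · have h₁ := intChoose_natCast (2 * (m + 1)) (m + 1)
    have h₂ := intChoose_natCast (2 * (m + 1)) m
    have h := Nat.choose_succ_right_eq (2 * (m + 1)) m
    rw [show 2 * (m + 1) - m = m + 2 by omega] at h
    zify at h
    push_cast at h₁ h₂ h ⊢
    rw [ballot, ← two_mul, add_sub_cancel_right, h₁, h₂, Nat.centralBinom]
    linarith

/-- The number of words with `k` green, `i` blue and `j` red letters, in which no prefix has more
blue than green or more red than blue letters, and no blue letter immediately follows a red one.
It is a two by two determinant of ballot numbers. -/
def wordCount (k i j : ℤ) : ℤ :=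
  ballot k i * ballot (k + 2) j - ballot (k + 1) (i + 1) * ballot (k + 1) (j - 1)

theorem wordCount_of_neg {k i j : ℤ} (hj : j < 0) : wordCount k i j = 0 := by
  rw [wordCount, ballot_of_neg hj, ballot_of_neg (by omega : j - 1 < 0)]
  ring

theorem wordCount_recursion {k i j : ℤ} (hj : 0 ≤ j) (hij : j ≤ i) (hk : 1 ≤ k) :
    wordCount k i j =
      wordCount (k - 1) i j + wordCount k i (j - 1) +
        (wordCount k (i - 1) j - wordCount k (i - 1) (j - 1)) := by
  have h₁ := ballot_recursion (show 1 ≤ k + i by omega)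
  have h₂ := ballot_recursion (show 1 ≤ k + 2 + j by omega)
  have h₃ := ballot_recursion (show 1 ≤ k + 1 + (i + 1) by omega)
  have h₄ := ballot_recursion (show 1 ≤ k + 1 + (j - 1) by omega)
  simp only [wordCount]
  rw [show k - 1 + 2 = k + 1 by ring, show k - 1 + 1 = k by ring, show i - 1 + 1 = i by ring]
  rw [show k + 2 - 1 = k + 1 by ring] at h₂
  rw [show k + 1 - 1 = k by ring, show i + 1 - 1 = i by ring] at h₃
  rw [show k + 1 - 1 = k by ring] at h₄
  -- Raising the lowered first arguments leaves a polynomial identity.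
  rw [show ballot (k - 1) i = ballot k i - ballot k (i - 1) by linarith,
    show ballot (k + 1) j = ballot (k + 2) j - ballot (k + 2) (j - 1) by linarith,
    show ballot k (i + 1) = ballot (k + 1) (i + 1) - ballot (k + 1) i by linarith,
    show ballot k (j - 1) = ballot (k + 1) (j - 1) - ballot (k + 1) (j - 1 - 1) by linarith]
  ring

/-- Boundary condition on the horizontal axis: a green step cannot come from below it. -/
theorem wordCount_pred_left_self {k j : ℤ} (hk : 1 ≤ k) : wordCount (k - 1) k j = 0 := by
  have h₁ := ballot_self_add_one (show 0 ≤ k - 1 by omega)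
  have h₂ := ballot_self_add_one (show 0 ≤ k by omega)
  rw [sub_add_cancel] at h₁
  rw [wordCount, h₁, sub_add_cancel, h₂]
  ring

/-- Boundary condition on the vertical axis: the blue term of the recursion, a difference, vanishes
there. -/
theorem wordCount_pred_self {k i : ℤ} (h : 1 ≤ k + i) :
    wordCount k (i - 1) i = wordCount k (i - 1) (i - 1) := by
  have h₁ := ballot_recursion (show 1 ≤ k + 2 + i by omega)
  have h₂ := ballot_recursion (show 1 ≤ k + 1 + (i - 1) by omega)
  rw [show k + 2 - 1 = k + 1 by ring] at h₁
  rw [show k + 1 - 1 = k by ring] at h₂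
  rw [wordCount, wordCount, sub_add_cancel]
  linear_combination ballot k (i - 1) * h₁ - ballot (k + 1) i * h₂

theorem wordCount_self (n : ℕ) :
    wordCount n n n * ((n + 1) ^ 2 * (n + 2) ^ 2 * (n + 3)) =
      12 * (2 * n + 1) * (n.centralBinom : ℤ) ^ 2 := by
  have c₀ := succ_mul_ballot_self n
  have c₁ := succ_mul_ballot_self (n + 1)
  have c₂ := succ_mul_ballot_self (n + 2)
  have b₁ := Nat.succ_mul_centralBinom_succ n
  have b₂ := Nat.succ_mul_centralBinom_succ (n + 1)
  have r₁ := ballot_recursion (show 1 ≤ (n : ℤ) + 2 + (n + 2) by omega)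
  have r₂ := ballot_recursion (show 1 ≤ (n : ℤ) + 2 + (n + 1) by omega)
  have r₃ := ballot_recursion (show 1 ≤ (n : ℤ) + 1 + (n + 1) by omega)
  have r₄ := ballot_recursion (show 1 ≤ (n : ℤ) + 1 + n by omega)
  have z₁ := ballot_self_add_one (show 0 ≤ (n : ℤ) + 1 by omega)
  have z₂ := ballot_self_add_one (show 0 ≤ (n : ℤ) by omega)
  zify at b₁ b₂
  push_cast at c₁ c₂ b₁ b₂
  rw [show (n : ℤ) + 2 - 1 = n + 1 by ring] at r₁ r₂
  rw [show (n : ℤ) + 1 + 1 = n + 2 by ring] at z₁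
  rw [show (n : ℤ) + 1 - 1 = n by ring] at r₂ r₃ r₄
  rw [wordCount]
  rw [show ballot (n + 2) n = ballot (n + 2) (n + 2) - ballot (n + 1) (n + 1) by linarith,
    show ballot (n + 1) (n - 1) = ballot (n + 1) (n + 1) - ballot n n by linarith]
  rw [show n + 1 + 1 = n + 2 by ring] at b₂
  generalize ballot (n : ℤ) n = x at *
  generalize ballot ((n : ℤ) + 1) (n + 1) = y at *
  generalize ballot ((n : ℤ) + 2) (n + 2) = z at *
  -- Here `x`, `y`, `z` are consecutive Catalan numbers; `e₁` and `e₂` are their two-term recursion.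
  have e₁ : ((n : ℤ) + 2) * y = 2 * (2 * n + 1) * x := by
    have : ((n : ℤ) + 1) ≠ 0 := by positivity
    refine mul_left_cancel₀ this ?_
    linear_combination ((n : ℤ) + 1) * c₁ + b₁ - 2 * (2 * n + 1) * c₀
  have e₂ : ((n : ℤ) + 3) * z = 2 * (2 * n + 3) * y := by
    have : ((n : ℤ) + 2) ≠ 0 := by positivity
    refine mul_left_cancel₀ this ?_
    linear_combination ((n : ℤ) + 2) * c₂ + b₂ - 2 * (2 * n + 3) * c₁
  rw [← c₀]
  have key : (x * (z - y) - y * (y - x)) * ((n + 2) ^ 2 * (n + 3)) = 12 * (2 * n + 1) * x ^ 2 := by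
    linear_combination x * ((n : ℤ) + 2) ^ 2 * e₂ + (x * (n + 2) * 2 * (2 * n + 3)
      - (n + 3) * ((n + 2) * y + 2 * (2 * n + 1) * x)) * e₁
  linear_combination ((n : ℤ) + 1) ^ 2 * key

theorem wordCount_self_pos (n : ℕ) : 0 < wordCount n n n := by
  have h := wordCount_self n
  have hc := n.centralBinom_pos
  refine pos_of_mul_pos_left (b := ((n : ℤ) + 1) ^ 2 * (n + 2) ^ 2 * (n + 3)) ?_ (by positivity)
  rw [h]
  positivity

theorem tendsto_wordCount_self :
    Filter.Tendsto (fun n : ℕ => (wordCount n n n : ℝ) * (2 / 16 ^ n) * (n : ℝ) ^ 5)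
      Filter.atTop (nhds (48 / Real.pi)) := by
  have hW : ∀ n : ℕ,
      Real.Wallis.W n * ((n.centralBinom : ℝ) ^ 2 * (2 * n + 1)) = 16 ^ n := by
    intro n
    have h := Nat.choose_mul_factorial_mul_factorial (show n ≤ 2 * n by omega)
    rw [show 2 * n - n = n by omega, ← Nat.centralBinom_eq_two_mul_choose] at h
    have h' : (n.centralBinom : ℝ) * n.factorial * n.factorial = (2 * n).factorial := by
      exact_mod_cast h
    have hf : (n.factorial : ℝ) ≠ 0 := by positivity
    have hc : (n.centralBinom : ℝ) ≠ 0 := by exact_mod_cast n.centralBinom_ne_zero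
    rw [Real.Wallis.W_eq_factorial_ratio, ← h', pow_mul]
    field_simp
    norm_num
  -- The five factors of `n ^ 5` are paired with those of the denominator, as `n / (n + a) = 1 - a /
  -- (n + a)`.
  have hlim : Filter.Tendsto (fun n : ℕ =>
      24 * ((1 - (1 : ℝ) / ((n : ℝ) + 1)) ^ 2 * ((1 - 2 / ((n : ℝ) + 2)) ^ 2 *
        (1 - 3 / ((n : ℝ) + 3)))) / Real.Wallis.W n) Filter.atTop (nhds (48 / Real.pi)) := by
    have h : ∀ a : ℝ, Filter.Tendsto (fun n : ℕ => 1 - a / ((n : ℝ) + a))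
        Filter.atTop (nhds 1) := by
      intro a
      have : Filter.Tendsto (fun n : ℕ => a / ((n : ℝ) + a)) Filter.atTop (nhds 0) :=
        (Filter.tendsto_atTop_add_const_right _ a tendsto_natCast_atTop_atTop).const_div_atTop a
      simpa using this.const_sub 1
    have := ((((h 1).pow 2).mul (((h 2).pow 2).mul (h 3))).const_mul 24).div
      Real.Wallis.tendsto_W_nhds_pi_div_two (by positivity)
    rw [show 48 / Real.pi = 24 * (1 ^ 2 * (1 ^ 2 * 1)) / (Real.pi / 2) by field_simp; norm_num]
    exact this
  refine hlim.congr fun n => ?_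
  have h : (wordCount n n n : ℝ) * ((n + 1) ^ 2 * (n + 2) ^ 2 * (n + 3)) =
      12 * (2 * n + 1) * (n.centralBinom : ℝ) ^ 2 := by exact_mod_cast wordCount_self n
  have hc : (n.centralBinom : ℝ) ≠ 0 := by exact_mod_cast n.centralBinom_ne_zero
  have hpos := (Real.Wallis.W_pos n).ne'
  rw [← hW, eq_div_of_mul_eq (by positivity) h]
  field_simp
  ring

end SchnyderWalk

/-! ### Admissible words and their enumeration -/

namespace SchnyderWalk

/-- The lattice path with increments prescribed by a word of colours. -/
def wordPath {N : ℕ} (u : Fin N → Color) : Fin (N + 1) → ℤ × ℤ :=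
  Fin.partialSum fun i => increment (u i)

@[simp]
theorem wordPath_zero {N : ℕ} (u : Fin N → Color) : wordPath u 0 = 0 :=
  Fin.partialSum_zero _

theorem wordPath_castSucc {N : ℕ} (u : Fin (N + 1) → Color) (k : Fin (N + 1)) :
    wordPath u k.castSucc = wordPath (Fin.init u) k :=
  (Fin.partialSum_init k).symm

theorem wordPath_last {N : ℕ} (u : Fin (N + 1) → Color) :
    wordPath u (Fin.last (N + 1)) =
      wordPath (Fin.init u) (Fin.last N) + increment (u (Fin.last N)) := by
  rw [← wordPath_castSucc, ← Fin.succ_last]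
  exact Fin.partialSum_succ _ _

theorem pathStep_wordPath {N : ℕ} (u : Fin N → Color) (i : Fin N) :
    pathStep (wordPath u) i = increment (u i) := by
  rw [pathStep, wordPath, Fin.partialSum_succ, add_sub_cancel_left]

theorem increment_injective : Function.Injective increment := by
  intro x y h
  cases x <;> cases y <;> simp_all [increment]

theorem wordPath_injective {N : ℕ} :
    Function.Injective (wordPath : (Fin N → Color) → Fin (N + 1) → ℤ × ℤ) := by
  intro u v h
  funext i
  apply increment_injective
  rw [← pathStep_wordPath, ← pathStep_wordPath, h]

theorem wordPath_eq_of_pathStep {N : ℕ} {z : Fin (N + 1) → ℤ × ℤ} {u : Fin N → Color}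
    (h₀ : z 0 = 0) (h : ∀ i, pathStep z i = increment (u i)) : wordPath u = z := by
  funext k
  induction k using Fin.induction with
  | zero => rw [wordPath_zero, h₀]
  | succ i ih =>
    have := (pathStep_wordPath u i).trans (h i).symm
    rw [pathStep, pathStep, ih] at this
    exact sub_left_injective this

/-- A word is admissible if its path stays in the closed first quadrant and no blue letter is
immediately preceded by a red one. -/
def IsAdmissible {N : ℕ} (u : Fin N → Color) : Prop :=
  (∀ k, 0 ≤ wordPath u k) ∧
    ∀ i j : Fin N, (j : ℕ) = (i : ℕ) + 1 → ¬(u i = Color.r ∧ u j = Color.b)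

/-- The last letter of the word exists and is red. -/
def EndsRed {N : ℕ} (u : Fin N → Color) : Prop :=
  ∃ i : Fin N, (i : ℕ) + 1 = N ∧ u i = Color.r

theorem endsRed_succ {N : ℕ} (u : Fin (N + 1) → Color) :
    EndsRed u ↔ u (Fin.last N) = Color.r := by
  constructor
  · rintro ⟨i, hi, h⟩
    rwa [← (Fin.ext (by simpa using hi) : i = Fin.last N)]
  · exact fun h => ⟨Fin.last N, rfl, h⟩

theorem isAdmissible_succ {N : ℕ} (u : Fin (N + 1) → Color) :
    IsAdmissible u ↔ IsAdmissible (Fin.init u) ∧ 0 ≤ wordPath u (Fin.last (N + 1)) ∧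
      ¬(EndsRed (Fin.init u) ∧ u (Fin.last N) = Color.b) := by
  constructor
  · rintro ⟨h₁, h₂⟩
    refine ⟨⟨fun k => ?_, fun i j hij => h₂ i.castSucc j.castSucc hij⟩, h₁ _, ?_⟩
    · rw [← wordPath_castSucc]
      exact h₁ _
    · rintro ⟨⟨i, hi, hr⟩, hb⟩
      exact h₂ i.castSucc (Fin.last N) hi.symm ⟨hr, hb⟩
  · rintro ⟨⟨h₁, h₂⟩, h₃, h₄⟩
    refine ⟨fun k => ?_, fun i j hij => ?_⟩
    · induction k using Fin.lastCases with
      | last => exact h₃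
      | cast k =>
        rw [wordPath_castSucc]
        exact h₁ k
    · induction j using Fin.lastCases with
      | last =>
        rintro ⟨hr, hb⟩
        have hi : (i : ℕ) < N := by simp at hij; omega
        exact h₄ ⟨⟨⟨i, hi⟩, by simpa using hij.symm, hr⟩, hb⟩
      | cast j =>
        have hi : (i : ℕ) < N := by simp at hij; omega
        exact h₂ ⟨i, hi⟩ j hij

open Classical in
/-- The admissible words of length `N` whose path ends at `p`. -/
noncomputable def admissibleWords (N : ℕ) (p : ℤ × ℤ) : Finset (Fin N → Color) :=
  Finset.univ.filter fun u => IsAdmissible u ∧ wordPath u (Fin.last N) = p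

theorem mem_admissibleWords {N : ℕ} {p : ℤ × ℤ} {u : Fin N → Color} :
    u ∈ admissibleWords N p ↔ IsAdmissible u ∧ wordPath u (Fin.last N) = p := by
  simp [admissibleWords]

theorem admissibleWords_eq_empty {N : ℕ} {p : ℤ × ℤ} (hp : ¬0 ≤ p) :
    admissibleWords N p = ∅ := by
  refine Finset.eq_empty_of_forall_notMem fun u hu => hp ?_
  rw [mem_admissibleWords] at hu
  exact hu.2 ▸ hu.1.1 _

-- Deleting and appending the last letter are inverse bijections; `hp` keeps the extended path in
-- the quadrant.
open Classical in
theorem card_admissibleWords_last (N : ℕ) {p : ℤ × ℤ} (hp : 0 ≤ p) (c : Color) :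
    ((admissibleWords (N + 1) p).filter fun u => u (Fin.last N) = c).card =
      ((admissibleWords N (p - increment c)).filter fun u => ¬(EndsRed u ∧ c = Color.b)).card := by
  refine Finset.card_nbij' Fin.init (fun v => Fin.snoc (α := fun _ => Color) v c) ?_ ?_ ?_ ?_
  · intro u hu
    simp only [Finset.coe_filter, Set.mem_ofPred_eq, mem_admissibleWords, isAdmissible_succ] at hu ⊢
    obtain ⟨⟨⟨h₁, -, h₃⟩, h₄⟩, rfl⟩ := hu
    exact ⟨⟨h₁, by rw [← h₄, wordPath_last, add_sub_cancel_right]⟩, h₃⟩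
  · intro v hv
    simp only [Finset.coe_filter, Set.mem_ofPred_eq, mem_admissibleWords, isAdmissible_succ,
      wordPath_last, Fin.init_snoc, Fin.snoc_last] at hv ⊢
    obtain ⟨⟨h₁, h₂⟩, h₃⟩ := hv
    rw [h₂, sub_add_cancel]
    exact ⟨⟨⟨h₁, hp, h₃⟩, rfl⟩, trivial⟩
  · intro u hu
    simp only [Finset.coe_filter, Set.mem_ofPred_eq] at hu
    rw [← hu.2]
    exact Fin.snoc_init_self u
  · intro v _
    exact Fin.init_snoc _ _

open Classical in
theorem card_admissibleWords_succ (N : ℕ) {p : ℤ × ℤ} (hp : 0 ≤ p) :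
    ((admissibleWords (N + 1) p).card : ℤ) =
      (admissibleWords N (p - (0, 1))).card + (admissibleWords N (p - (-1, 0))).card +
        ((admissibleWords N (p - (1, -1))).card -
          ((admissibleWords N (p - (1, -1))).filter EndsRed).card) := by
  have h := Finset.card_eq_sum_card_fiberwise (f := fun u : Fin (N + 1) → Color => u (Fin.last N))
    (s := admissibleWords (N + 1) p) (t := Finset.univ)
    fun _ _ => Finset.mem_coe.2 (Finset.mem_univ _)
  simp only [card_admissibleWords_last N hp] at h
  have hs : ∀ F : Color → ℕ, ∑ c, F c = F .b + (F .r + F .g) := fun F => by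
    rw [show (Finset.univ : Finset Color) = {.b, .r, .g} from rfl]
    simp
  have hb := Finset.card_filter_add_card_filter_not (s := admissibleWords N (p - (1, -1))) EndsRed
  rw [hs] at h
  simp [increment] at h
  omega

open Classical in
theorem card_admissibleWords_endsRed_succ (N : ℕ) {p : ℤ × ℤ} (hp : 0 ≤ p) :
    ((admissibleWords (N + 1) p).filter EndsRed).card =
      (admissibleWords N (p - (-1, 0))).card := by
  have h := card_admissibleWords_last N hp Color.r
  simp only [← endsRed_succ] at h
  simpa [increment] using h

-- The two counts need a joint induction, as appending blue excludes words ending in red. Negative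
-- `j` is allowed because the step passes from `j` to `j - 1`; both sides then vanish.
open Classical in
theorem card_admissibleWords (N : ℕ) : ∀ k i j : ℤ, j ≤ i → i ≤ k → k + i + j = N →
    ((admissibleWords N (i - j, k - i)).card : ℤ) = wordCount k i j ∧
    (((admissibleWords N (i - j, k - i)).filter EndsRed).card : ℤ) = wordCount k i (j - 1) := by
  induction N with
  | zero =>
    intro k i j hij hik hN
    have hred : (admissibleWords 0 (i - j, k - i)).filter EndsRed = ∅ :=
      Finset.filter_false_of_mem fun u _ ⟨l, _⟩ => l.elim0
    rw [hred, Finset.card_empty, wordCount_of_neg (show j - 1 < 0 by push_cast at hN; omega)]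
    refine ⟨?_, rfl⟩
    rcases lt_or_ge j 0 with hj | hj
    · rw [wordCount_of_neg hj]
      simp only [Nat.cast_eq_zero, Finset.card_eq_zero]
      refine Finset.eq_empty_of_forall_notMem fun u hu => ?_
      have h := (mem_admissibleWords.1 hu).2
      rw [Fin.last_zero, wordPath_zero, Prod.ext_iff] at h
      simp at h hN
      omega
    · obtain ⟨rfl, rfl, rfl⟩ : k = 0 ∧ i = 0 ∧ j = 0 := by push_cast at hN; omega
      have : admissibleWords 0 ((0 : ℤ) - 0, (0 : ℤ) - 0) = Finset.univ := by
        ext u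
        simp only [mem_admissibleWords, Finset.mem_univ, iff_true]
        refine ⟨⟨fun k => ?_, fun l => l.elim0⟩, wordPath_zero u⟩
        rw [Subsingleton.elim (α := Fin 1) k 0, wordPath_zero]
      rw [this]
      simp [wordCount, ballot, intChoose]
  | succ N ih =>
    intro k i j hij hik hN
    push_cast at hN
    have hp : (0 : ℤ × ℤ) ≤ (i - j, k - i) := Prod.le_def.2 ⟨by simpa, by simpa⟩
    have hr : ((admissibleWords N ((i - j, k - i) - (-1, 0))).card : ℤ) = wordCount k i (j - 1) := by
      rw [← (ih k i (j - 1) (by omega) hik (by omega)).1]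
      congr 3
      ext <;> simp
      ring
    refine ⟨?_, by rw [card_admissibleWords_endsRed_succ N hp, hr]⟩
    have hg : ((admissibleWords N ((i - j, k - i) - (0, 1))).card : ℤ) = wordCount (k - 1) i j := by
      rcases hik.lt_or_eq with h | rfl
      · rw [← (ih (k - 1) i j hij (by omega) (by omega)).1]
        congr 3
        ext <;> simp
        ring
      · rw [wordCount_pred_left_self (by omega), admissibleWords_eq_empty (by simp [Prod.le_def])]
        simp
    have hb : ((admissibleWords N ((i - j, k - i) - (1, -1))).card : ℤ) -
        ((admissibleWords N ((i - j, k - i) - (1, -1))).filter EndsRed).card =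
          wordCount k (i - 1) j - wordCount k (i - 1) (j - 1) := by
      rcases hij.lt_or_eq with h | rfl
      · have hq : ((i - j, k - i) - (1, -1) : ℤ × ℤ) = (i - 1 - j, k - (i - 1)) := by
          ext <;> simp <;> ring
        obtain ⟨h₁, h₂⟩ := ih k (i - 1) j (by omega) (by omega) (by omega)
        rw [hq, h₁, h₂]
      · rw [wordCount_pred_self (by omega), admissibleWords_eq_empty (by simp [Prod.le_def])]
        simp
    rw [card_admissibleWords_succ N hp, hg, hr, hb]
    rcases lt_or_ge j 0 with hj | hj
    · simp [wordCount_of_neg hj, wordCount_of_neg (show j - 1 < 0 by omega)]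
    · exact (wordCount_recursion hj hij (by omega)).symm

theorem card_admissibleWords_origin (n : ℕ) :
    ((admissibleWords (3 * n) (0, 0)).card : ℤ) = wordCount n n n := by
  have h := (card_admissibleWords (3 * n) n n n le_rfl le_rfl (by push_cast; ring)).1
  rwa [sub_self] at h

theorem walkSet_eq_image (n : ℕ) :
    walkSet n = wordPath '' (admissibleWords (3 * n) (0, 0) : Set (Fin (3 * n) → Color)) := by
  ext z
  simp only [Set.mem_image, SetLike.mem_coe, mem_admissibleWords]
  constructor
  · rintro ⟨h₀, h₁, h₂, h₃, h₄⟩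
    have hu : ∀ i, ∃ c, pathStep z i = increment c := by
      intro i
      rcases h₃ i with h | h | h
      exacts [⟨.g, h⟩, ⟨.r, h⟩, ⟨.b, h⟩]
    choose u hu using hu
    have hz : wordPath u = z := wordPath_eq_of_pathStep h₀ hu
    refine ⟨u, ⟨⟨fun k => ?_, fun i j hij h => h₄ i j hij ?_⟩, ?_⟩, hz⟩
    · rw [hz]
      exact Prod.le_def.2 (h₂ k)
    · rw [hu, hu, h.1, h.2]
      exact ⟨rfl, rfl⟩
    · rw [hz, h₁]
  · rintro ⟨u, ⟨⟨h₁, h₂⟩, h₃⟩, rfl⟩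
    refine ⟨wordPath_zero u, h₃, fun k => Prod.le_def.1 (h₁ k), fun i => ?_, fun i j hij h => ?_⟩
    · rw [pathStep_wordPath]
      cases u i <;> simp [increment]
    · rw [pathStep_wordPath, pathStep_wordPath] at h
      exact h₂ i j hij ⟨increment_injective h.1, increment_injective h.2⟩

end SchnyderWalk

/-! ### The law of the walk driven by the Markov chain -/

namespace SchnyderWalk

open MeasureTheory ProbabilityTheory

instance : DiscreteMeasurableSpace Color := ⟨fun _ => trivial⟩

section General

variable {Ω : Type*} [MeasurableSpace Ω] {μ : Measure Ω}

theorem IsMarkovChain.measureReal_prefix_succ {S : Type*} [MeasurableSpace S]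
    [MeasurableSingletonClass S] [IsProbabilityMeasure μ] {P : Matrix S S ℝ} {x₀ : S} {N : ℕ}
    {w : Fin N → Ω → S} (hw : IsMarkovChain μ P x₀ w) {i j : Fin N} (hij : (j : ℕ) = (i : ℕ) + 1)
    (x : Fin N → S) :
    μ.real {ω | ∀ l ≤ j, w l ω = x l} =
      μ.real {ω | ∀ l ≤ i, w l ω = x l} * P (x i) (x j) := by
  have hE : {ω | ∀ l ≤ j, w l ω = x l} = {ω | ∀ l ≤ i, w l ω = x l} ∩ {ω | w j ω = x j} := by
    ext ω
    refine ⟨fun h => ⟨fun l hl => h l (hl.trans (Fin.le_def.2 (by omega))), h j le_rfl⟩,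
      fun h l hl => ?_⟩
    rcases hl.lt_or_eq with hl | rfl
    · exact h.1 l (Fin.le_def.2 (by have := Fin.lt_def.1 hl; omega))
    · exact h.2
  have hmeas : MeasurableSet {ω | ∀ l ≤ i, w l ω = x l} := by
    have : {ω | ∀ l ≤ i, w l ω = x l} = ⋂ l, ⋂ (_ : l ≤ i), w l ⁻¹' {x l} := by
      ext ω
      simp
    rw [this]
    exact MeasurableSet.iInter fun l => MeasurableSet.iInter fun _ =>
      hw.measurable l (measurableSet_singleton _)
  -- The Markov property says nothing about null histories, but then both sides are zero.
  by_cases h₀ : μ {ω | ∀ l ≤ i, w l ω = x l} = 0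
  · rw [hE, measureReal_def, measureReal_def, h₀, measure_mono_null Set.inter_subset_left h₀]
    simp
  · rw [hE, ← hw.step i j hij x (x j) h₀, measureReal_def, measureReal_def, measureReal_def,
      ← ENNReal.toReal_mul, mul_comm, cond_mul_eq_inter hmeas]

variable {α : Type*} [MeasurableSpace α] [MeasurableSingletonClass α] {X : Ω → α} {S : Finset α}
  {p : ENNReal}

theorem measure_mem_finset_of_forall_eq (hX : Measurable X)
    (hp : ∀ z ∈ S, μ {ω | X ω = z} = p) : μ {ω | X ω ∈ S} = S.card * p := by
  have h : ∑ z ∈ S, μ {ω | X ω = z} = μ {ω | X ω ∈ S} :=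
    sum_measure_preimage_singleton S fun z _ => hX (measurableSet_singleton z)
  rw [← h, Finset.sum_congr rfl hp, Finset.sum_const, nsmul_eq_mul]

theorem map_cond_eq_uniformOn [Countable α] [IsFiniteMeasure μ] (hX : Measurable X)
    (hp : ∀ z ∈ S, μ {ω | X ω = z} = p) (hS : S.Nonempty) (hp₀ : p ≠ 0) :
    Measure.map X (cond μ {ω | X ω ∈ S}) = uniformOn (S : Set α) := by
  obtain ⟨z₀, hz₀⟩ := hS
  have hp₁ : p ≠ ⊤ := hp z₀ hz₀ ▸ measure_ne_top _ _
  have hmS : MeasurableSet {ω | X ω ∈ S} := hX S.measurableSet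
  refine Measure.ext_of_singleton fun z => ?_
  rw [Measure.map_apply hX (measurableSet_singleton z), cond_apply hmS, uniformOn,
    cond_apply S.measurableSet, measure_mem_finset_of_forall_eq hX hp, Measure.count_apply_finset]
  by_cases hz : z ∈ S
  · have h₁ : {ω | X ω ∈ S} ∩ X ⁻¹' {z} = {ω | X ω = z} := by
      ext ω
      exact ⟨fun h => h.2, fun h => ⟨(congrArg (· ∈ S) (show X ω = z from h)).mpr hz, h⟩⟩
    have h₂ : (S : Set α) ∩ {z} = {z} := by simpa using hz
    rw [h₁, h₂, hp z hz, Measure.count_singleton, mul_one,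
      ENNReal.mul_inv (Or.inr hp₁) (Or.inr hp₀), mul_assoc, ENNReal.inv_mul_cancel hp₀ hp₁, mul_one]
  · have h₁ : {ω | X ω ∈ S} ∩ X ⁻¹' {z} = ∅ := by
      refine Set.eq_empty_of_forall_notMem fun ω h => hz ?_
      have := h.1
      rwa [Set.mem_ofPred_eq, show X ω = z from h.2] at this
    have h₂ : (S : Set α) ∩ {z} = ∅ := by simpa using hz
    rw [h₁, h₂, measure_empty, measure_empty, mul_zero, mul_zero]

end General

/-- The factor of the transition probability depending on the state which is left. -/
noncomputable def leaveWeight : Color → ℝ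
  | .b => 1
  | .r => 2
  | .g => 1

/-- The factor of the transition probability depending on the state which is entered. -/
noncomputable def enterWeight : Color → ℝ
  | .b => 1 / 2
  | .r => 1 / 4
  | .g => 1 / 4

theorem transition_eq_mul {x y : Color} (h : ¬(x = Color.r ∧ y = Color.b)) :
    transition x y = leaveWeight x * enterWeight y := by
  cases x <;> cases y <;> simp_all [transition, leaveWeight, enterWeight] <;> norm_num

/-- The factorised transitions telescope. The constant 4 is `1 / enterWeight .g`, since the first
letter is deterministic; the extra `leaveWeight` completes the weight of the last letter. -/
theorem measureReal_prefix_mul_leaveWeight {Ω : Type*} [MeasurableSpace Ω] {μ : Measure Ω}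
    [IsProbabilityMeasure μ] {N : ℕ} {w : Fin N → Ω → Color}
    (hw : IsMarkovChain μ transition Color.g w) {u : Fin N → Color} (hu : IsAdmissible u)
    (hg : ∀ i : Fin N, (i : ℕ) = 0 → u i = Color.g) (m : ℕ) (hm : m < N) :
    μ.real {ω | ∀ l ≤ (⟨m, hm⟩ : Fin N), w l ω = u l} * leaveWeight (u ⟨m, hm⟩) =
      4 * ∏ l ∈ Finset.Iic (⟨m, hm⟩ : Fin N), leaveWeight (u l) * enterWeight (u l) := by
  induction m with
  | zero =>
    have h₁ : Finset.Iic (⟨0, hm⟩ : Fin N) = {⟨0, hm⟩} := by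
      ext l
      simp [Fin.le_def, Fin.ext_iff]
    have h₂ : μ {ω | ∀ l ≤ (⟨0, hm⟩ : Fin N), w l ω = u l} = 1 := by
      rw [← measure_univ (μ := μ)]
      refine measure_congr ?_
      filter_upwards [hw.initial ⟨0, hm⟩ rfl] with ω hω
      refine eq_true fun l hl => ?_
      obtain rfl : l = ⟨0, hm⟩ := Fin.ext (Nat.le_zero.1 hl)
      rw [hω, hg _ rfl]
    rw [measureReal_def, h₂, h₁, Finset.prod_singleton, hg _ rfl]
    norm_num [leaveWeight, enterWeight]
  | succ m ih =>
    have h₁ : Finset.Iic (⟨m + 1, hm⟩ : Fin N) =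
        insert ⟨m + 1, hm⟩ (Finset.Iic (⟨m, by omega⟩ : Fin N)) := by
      ext l
      simp [Fin.le_def, Fin.ext_iff]
      omega
    have h₂ := hw.measureReal_prefix_succ (i := ⟨m, by omega⟩) (j := ⟨m + 1, hm⟩) rfl u
    rw [transition_eq_mul (hu.2 ⟨m, by omega⟩ ⟨m + 1, hm⟩ rfl)] at h₂
    rw [h₂, h₁, Finset.prod_insert (by simp [Fin.le_def])]
    linear_combination leaveWeight (u ⟨m + 1, hm⟩) * enterWeight (u ⟨m + 1, hm⟩) * ih (by omega)

/-- Letters have weight `2⁻¹` to this power. -/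
def weightExponent : Color → ℕ
  | .b => 1
  | .r => 1
  | .g => 2

theorem leaveWeight_mul_enterWeight (c : Color) :
    leaveWeight c * enterWeight c = (1 / 2) ^ weightExponent c := by
  cases c <;> norm_num [leaveWeight, enterWeight, weightExponent]

/-- Being affine in the increment, the exponent has a total on a closed path that depends only on
its length. -/
theorem three_mul_weightExponent (c : Color) :
    3 * (weightExponent c : ℤ) = 4 + (increment c).1 + 2 * (increment c).2 := by
  cases c <;> simp [weightExponent, increment]

theorem wordPath_last_eq_sum {N : ℕ} (u : Fin N → Color) :
    wordPath u (Fin.last N) = ∑ i, increment (u i) := by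
  simp [wordPath, Fin.partialSum, ← List.sum_ofFn, List.take_of_length_le]

theorem prod_leaveWeight_mul_enterWeight {n : ℕ} {u : Fin (3 * n) → Color}
    (hu : u ∈ admissibleWords (3 * n) (0, 0)) :
    ∏ l, leaveWeight (u l) * enterWeight (u l) = 1 / 16 ^ n := by
  have h := (mem_admissibleWords.1 hu).2
  rw [wordPath_last_eq_sum, Prod.ext_iff, Prod.fst_sum, Prod.snd_sum] at h
  have hsum : ∑ l, (3 * (weightExponent (u l) : ℤ)) = 4 * (3 * n) := by
    simp only [three_mul_weightExponent, Finset.sum_add_distrib, ← Finset.mul_sum, h.1, h.2]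
    simp [mul_comm]
  rw [← Finset.mul_sum] at hsum
  have hexp : ∑ l, weightExponent (u l) = 4 * n := by
    zify
    linarith
  simp only [leaveWeight_mul_enterWeight]
  rw [Finset.prod_pow_eq_pow_sum, hexp, pow_mul, ← one_div_pow]
  norm_num

theorem first_eq_green {N : ℕ} {u : Fin N → Color} (hu : IsAdmissible u) (i : Fin N)
    (hi : (i : ℕ) = 0) : u i = Color.g := by
  have h₀ : wordPath u i.castSucc = 0 := by
    rw [show i.castSucc = 0 from Fin.ext hi, wordPath_zero]
  have h : 0 ≤ increment (u i) := by
    have := pathStep_wordPath u i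
    rw [pathStep, h₀, sub_zero] at this
    exact this ▸ hu.1 i.succ
  cases hc : u i <;> simp_all [increment, Prod.le_def]

/-- Of the three steps, only red can reach the origin from within the quadrant. -/
theorem last_eq_red {N : ℕ} {u : Fin (N + 1) → Color} (hu : u ∈ admissibleWords (N + 1) (0, 0)) :
    u (Fin.last N) = Color.r := by
  obtain ⟨h₁, h₂⟩ := mem_admissibleWords.1 hu
  have h := ((isAdmissible_succ u).1 h₁).1.1 (Fin.last N)
  rw [wordPath_last] at h₂
  rw [eq_sub_of_add_eq h₂] at h
  cases hc : u (Fin.last N) <;> simp_all [increment, Prod.le_def]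

theorem measurable_walk {Ω : Type*} [MeasurableSpace Ω] {N : ℕ} {w : Fin N → Ω → Color}
    (hw : ∀ i, Measurable (w i)) : Measurable (walk w) := by
  have h : walk w = wordPath ∘ fun ω i => w i ω := rfl
  rw [h]
  exact (measurable_of_countable _).comp (measurable_pi_lambda _ hw)

theorem measureReal_walk_eq {Ω : Type*} [MeasurableSpace Ω] {μ : Measure Ω}
    [IsProbabilityMeasure μ] {n : ℕ} (hn : 1 ≤ n) {w : Fin (3 * n) → Ω → Color}
    (hw : IsMarkovChain μ transition Color.g w) {z : Fin (3 * n + 1) → ℤ × ℤ}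
    (hz : z ∈ walkSet n) : μ.real {ω | walk w ω = z} = 2 / 16 ^ n := by
  rw [walkSet_eq_image] at hz
  obtain ⟨u, hu, rfl⟩ := hz
  have hu' : IsAdmissible u := (mem_admissibleWords.1 hu).1
  have h := measureReal_prefix_mul_leaveWeight hw hu' (first_eq_green hu') (3 * n - 1) (by omega)
  have hle : ∀ l : Fin (3 * n), l ≤ ⟨3 * n - 1, by omega⟩ := fun l => Fin.le_def.2 (by
    have := l.2
    simp only
    omega)
  have hlast : u ⟨3 * n - 1, by omega⟩ = Color.r := by
    obtain ⟨N, hN⟩ : ∃ N, 3 * n = N + 1 := ⟨3 * n - 1, by omega⟩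
    -- Generalising the length to a variable allows `3 * n` to be replaced by a successor in the
    -- type of the word.
    have key : ∀ M (hM : M = N + 1) (v : Fin M → Color), v ∈ admissibleWords M (0, 0) →
        v ⟨M - 1, by omega⟩ = Color.r := by
      rintro M rfl v hv
      exact last_eq_red hv
    exact key _ hN u hu
  have hset : {ω | ∀ l ≤ (⟨3 * n - 1, by omega⟩ : Fin (3 * n)), w l ω = u l} =
      {ω | walk w ω = wordPath u} := by
    ext ω
    refine ⟨fun h => congrArg wordPath (funext fun l => h l (hle l)), fun h l _ => ?_⟩
    exact congrFun (wordPath_injective (h : wordPath (fun i => w i ω) = wordPath u)) l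
  have hIic : Finset.Iic (⟨3 * n - 1, by omega⟩ : Fin (3 * n)) = Finset.univ := by
    ext l
    simpa using hle l
  rw [hset, hlast, hIic, prod_leaveWeight_mul_enterWeight hu, leaveWeight] at h
  -- The division by 2 removes the `leaveWeight` of the final red letter.
  linear_combination h / 2

theorem walkSet_eq_coe_image (n : ℕ) :
    walkSet n = ((admissibleWords (3 * n) (0, 0)).map ⟨wordPath, wordPath_injective⟩ :
      Finset (Fin (3 * n + 1) → ℤ × ℤ)) := by
  rw [walkSet_eq_image, Finset.coe_map]
  rfl

theorem measureReal_walk_mem_walkSet {Ω : Type*} [MeasurableSpace Ω] {μ : Measure Ω}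
    [IsProbabilityMeasure μ] {n : ℕ} (hn : 1 ≤ n) {w : Fin (3 * n) → Ω → Color}
    (hw : IsMarkovChain μ transition Color.g w) :
    μ.real {ω | walk w ω ∈ walkSet n} = wordCount n n n * (2 / 16 ^ n) := by
  have hp : ∀ z ∈ (admissibleWords (3 * n) (0, 0)).map ⟨wordPath, wordPath_injective⟩,
      μ {ω | walk w ω = z} = ENNReal.ofReal (2 / 16 ^ n) := by
    intro z hz
    rw [← measureReal_walk_eq hn hw ((walkSet_eq_coe_image n).symm ▸ Finset.mem_coe.2 hz),
      ofReal_measureReal]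
  have h := measure_mem_finset_of_forall_eq (measurable_walk hw.measurable) hp
  rw [walkSet_eq_coe_image]
  simp only [Finset.mem_coe]
  rw [measureReal_def, h, ENNReal.toReal_mul, ENNReal.toReal_ofReal (by positivity),
    Finset.card_map, ← card_admissibleWords_origin]
  simp

theorem map_walk_cond {Ω : Type*} [MeasurableSpace Ω] {μ : Measure Ω}
    [IsProbabilityMeasure μ] {n : ℕ} (hn : 1 ≤ n) {w : Fin (3 * n) → Ω → Color}
    (hw : IsMarkovChain μ transition Color.g w) :
    Measure.map (walk w) (cond μ {ω | walk w ω ∈ walkSet n}) = uniformOn (walkSet n) := by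
  have hp : ∀ z ∈ (admissibleWords (3 * n) (0, 0)).map ⟨wordPath, wordPath_injective⟩,
      μ {ω | walk w ω = z} = ENNReal.ofReal (2 / 16 ^ n) := by
    intro z hz
    rw [← measureReal_walk_eq hn hw ((walkSet_eq_coe_image n).symm ▸ Finset.mem_coe.2 hz),
      ofReal_measureReal]
  have hne : ((admissibleWords (3 * n) (0, 0)).map
      ⟨wordPath, wordPath_injective⟩).Nonempty := by
    rw [Finset.map_nonempty, ← Finset.card_pos]
    have := wordCount_self_pos n
    rw [← card_admissibleWords_origin] at this
    exact_mod_cast this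
  rw [walkSet_eq_coe_image]
  exact map_cond_eq_uniformOn (measurable_walk hw.measurable) hp hne
    (ENNReal.ofReal_pos.2 (by positivity)).ne'

end SchnyderWalk

theorem proposition2p6
    {Ω : ℕ → Type*} [∀ n, MeasurableSpace (Ω n)]
    (μ : ∀ n, MeasureTheory.Measure (Ω n)) [∀ n, MeasureTheory.IsProbabilityMeasure (μ n)]
    (w : ∀ n : ℕ, Fin (3 * n) → Ω n → SchnyderWalk.Color)
    (hw : ∀ n : ℕ, 1 ≤ n →
      SchnyderWalk.IsMarkovChain (μ n) SchnyderWalk.transition SchnyderWalk.Color.g (w n)) :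
    (∀ n : ℕ, 1 ≤ n →
      (SchnyderWalk.walkSet n).Finite ∧
      0 < (μ n).real {ω | SchnyderWalk.walk (w n) ω ∈ SchnyderWalk.walkSet n} ∧
      (∀ z ∈ SchnyderWalk.walkSet n,
        (μ n).real {ω | SchnyderWalk.walk (w n) ω = z} = 2 / 16 ^ n) ∧
      MeasureTheory.Measure.map (SchnyderWalk.walk (w n))
          (ProbabilityTheory.cond (μ n)
            {ω | SchnyderWalk.walk (w n) ω ∈ SchnyderWalk.walkSet n}) =
        ProbabilityTheory.uniformOn (SchnyderWalk.walkSet n)) ∧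
    ∃ ε : ℕ → ℝ, Filter.Tendsto ε Filter.atTop (nhds 0) ∧
      ∀ n : ℕ, 1 ≤ n →
        (μ n).real {ω | SchnyderWalk.walk (w n) ω ∈ SchnyderWalk.walkSet n} =
          (48 / Real.pi + ε n) * (n : ℝ) ^ (-5 : ℤ) := by
  refine ⟨fun n hn => ⟨?_, ?_, fun z hz => SchnyderWalk.measureReal_walk_eq hn (hw n hn) hz,
    SchnyderWalk.map_walk_cond hn (hw n hn)⟩,
    -- The error term is forced by solving the required identity for it.
    fun n => (μ n).real {ω | SchnyderWalk.walk (w n) ω ∈ SchnyderWalk.walkSet n} * (n : ℝ) ^ 5 -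
      48 / Real.pi, ?_, fun n hn => ?_⟩
  · rw [SchnyderWalk.walkSet_eq_coe_image]
    exact Finset.finite_toSet _
  · rw [SchnyderWalk.measureReal_walk_mem_walkSet hn (hw n hn)]
    have : (0 : ℝ) < SchnyderWalk.wordCount n n n := by
      exact_mod_cast SchnyderWalk.wordCount_self_pos n
    positivity
  · rw [← sub_self (48 / Real.pi)]
    -- Only eventual equality is available, as `hw` starts at `n = 1`.
    refine (SchnyderWalk.tendsto_wordCount_self.sub_const _).congr' ?_
    filter_upwards [Filter.eventually_ge_atTop 1] with n hn
    rw [SchnyderWalk.measureReal_walk_mem_walkSet hn (hw n hn)]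
  · have : (n : ℝ) ≠ 0 := by positivity
    rw [add_sub_cancel, mul_assoc, zpow_neg, show (n : ℝ) ^ (5 : ℤ) = (n : ℝ) ^ 5 by norm_cast,
      mul_inv_cancel₀ (pow_ne_zero 5 this), mul_one]
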